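/- **Proposition 3.6.** Let $\Lambda$ be an Artin algebra, that is, a ring which is an algebra, finitely generated as a module, over a commutative Artinian ring $R$. Let $M$ be a finitely generated left $\Lambda$-module that is indecomposable (in particular nonzero) and faithful (its annihilator in $\Lambda$ is zero). Let $P_1 \xrightarrow{f} P_0 \to M \to 0$ be a minimal projective presentation of $M$ by finitely generated projective modules, write $(-)^* = \operatorname{Hom}_\Lambda(-,\Lambda)$, and let $\operatorname{Tr} M = \operatorname{Coker}(f^* : P_0^* \to P_1^*)$, a left $\Lambda^{op}$-module. A left module $X$ over a ring $A$ is called torsionless if the evaluation map $X \to X^{**}$, $x \mapsto (\varphi \mapsto \varphi(x))$, is injective, where $X^* = \operatorname{Hom}_A(X, A)$ and $X^{**} = \operatorname{Hom}_{A^{op}}(X^*, A)$. Then: 1. $\operatorname{Tr} M$ is torsionless if and only if $\operatorname{Ext}^1_\Lambda(M,\Lambda)=0$. 2. If $\operatorname{Tr} M$ is torsionless and $\operatorname{Ext}^1_{\Lambda^{op}}(\operatorname{Tr} M,\operatorname{Tr} M)=0$, then $M$ is projective. -/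

import Mathlib

universe u w

open CategoryTheory

section Transpose

variable {A : Type*} [Ring A]

/-- A submodule `N` of `X` is superfluous if `N + L = X` forces `L = X`. -/
def IsSuperfluous {X : Type*} [AddCommGroup X] [Module A X] (N : Submodule A X) : Prop :=
  ∀ L : Submodule A X, N ⊔ L = ⊤ → L = ⊤

/-- `P₁ --f--> P₀ --g--> M ⟶ 0` is a minimal projective presentation of `M` (the beginning of a
minimal projective resolution): `P₀`, `P₁` are finitely generated projective, the sequence is
exact, and `P₀ → M` and `P₁ → Ker g` are projective covers. -/
structure IsMinimalProjectivePresentation {P₁ P₀ M : Type*}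
    [AddCommGroup P₁] [Module A P₁] [AddCommGroup P₀] [Module A P₀] [AddCommGroup M] [Module A M]
    (f : P₁ →ₗ[A] P₀) (g : P₀ →ₗ[A] M) : Prop where
  finite₁ : Module.Finite A P₁
  finite₀ : Module.Finite A P₀
  projective₁ : Module.Projective A P₁
  projective₀ : Module.Projective A P₀
  exact : Function.Exact f g
  surjective : Function.Surjective g
  superfluous₁ : IsSuperfluous (LinearMap.ker f)
  superfluous₀ : IsSuperfluous (LinearMap.ker g)

variable {X Y : Type*} [AddCommGroup X] [Module A X] [AddCommGroup Y] [Module A Y]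

/-- `f^* : Y^* → X^*`, `φ ↦ φ ∘ f`, where `X^* = Hom_A(X, A)` is a right `A`-module
(a left `Aᵐᵒᵖ`-module) through the right multiplication of `A` on itself. -/
def ringDualMap (f : X →ₗ[A] Y) : (Y →ₗ[A] A) →ₗ[Aᵐᵒᵖ] (X →ₗ[A] A) where
  toFun φ := φ.comp f
  map_add' _ _ := rfl
  map_smul' _ _ := rfl

/-- `Coker f^*`, a left `Aᵐᵒᵖ`-module. It is the transpose `Tr M` when `f : P₁ → P₀` belongs to
a minimal projective presentation of `M`. -/
abbrev CokerDual (f : X →ₗ[A] Y) : Type _ :=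
  (X →ₗ[A] A) ⧸ LinearMap.range (ringDualMap f)

/-- The canonical evaluation homomorphism `σ_X : X → X^{**}`, `σ_X(x)(φ) = φ(x)`. -/
def evalBidual (A : Type*) [Ring A] (X : Type*) [AddCommGroup X] [Module A X] :
    X →ₗ[A] ((X →ₗ[A] A) →ₗ[Aᵐᵒᵖ] A) where
  toFun x :=
    { toFun := fun φ => φ x
      map_add' := fun _ _ => rfl
      map_smul' := fun _ _ => rfl }
  map_add' x y := by ext φ; exact φ.map_add x y
  map_smul' a x := by ext φ; exact φ.map_smul a x

/-- `X` is torsionless if `σ_X` is a monomorphism. -/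
def IsTorsionless (A : Type*) [Ring A] (X : Type*) [AddCommGroup X] [Module A X] : Prop :=
  Function.Injective (evalBidual A X)

end Transpose

/-! Both halves of the first claim say that every form on `P₁` killing `Ker f` factors through `f`:
by dimension shifting for `Ext¹`, and because, by reflexivity, forms on `Tr M` are evaluations at
elements of `Ker f`. For the second, let `M` be non-projective. By Fitting's lemma all forms on `M`
take values in the radical `J`. If `Tr M ≠ 0`, pick `s ≠ 0` in it with `sJ = 0`. For `p` in `P₀` the
map `φ ↦ s φ(p)` kills `Ker f^* = M^*`, so it extends along `f^*`; composing with a form `χ` on `Tr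
M` gives `q` in `P₁` with `f q = χ(s) p`. Hence `χ(s)` annihilates `M`, so `χ(s) = 0` by
faithfulness, against torsionlessness. So `Tr M = 0` and `f` splits. -/

section Ext

variable {A : Type u} [Ring A]

/-- For an exact sequence `Q → P → X → 0` with `P` projective, `Ext¹(X, Y) = 0` if and only if every
`h : Q → Y` vanishing on the kernel of `Q → P` factors through `P`. -/
theorem subsingleton_ext_one_iff {Q : Type*} {P X Y : Type u}
    [AddCommGroup Q] [Module A Q] [AddCommGroup P] [Module A P]
    [AddCommGroup X] [Module A X] [AddCommGroup Y] [Module A Y] [Module.Projective A P]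
    {f : Q →ₗ[A] P} {g : P →ₗ[A] X} (hfg : Function.Exact f g) (hg : Function.Surjective g) :
    Subsingleton (Abelian.Ext (ModuleCat.of A X) (ModuleCat.of A Y) 1) ↔
      ∀ h : Q →ₗ[A] Y, LinearMap.ker f ≤ LinearMap.ker h → ∃ k : P →ₗ[A] Y, k ∘ₗ f = h := by
  let S : ShortComplex (ModuleCat.{u} A) :=
    { X₁ := ModuleCat.of A (LinearMap.range f)
      X₂ := ModuleCat.of A P
      X₃ := ModuleCat.of A X
      f := ModuleCat.ofHom (LinearMap.range f).subtype
      g := ModuleCat.ofHom g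
      zero := by
        ext ⟨_, q, rfl⟩
        exact hfg.apply_apply_eq_zero q }
  have hS : S.ShortExact :=
    { exact := by
        rw [ShortComplex.ShortExact.moduleCat_exact_iff_function_exact]
        intro x
        refine (hfg x).trans ⟨fun hx => ⟨⟨x, hx⟩, rfl⟩, ?_⟩
        rintro ⟨y, rfl⟩
        exact y.2
      mono_f := (ModuleCat.mono_iff_injective _).2 Subtype.val_injective
      epi_g := (ModuleCat.epi_iff_surjective _).2 hg }
  have hP : Projective S.X₂ := (IsProjective.iff_projective P).1 inferInstance
  constructor
  · intro hsub h hker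
    let h' : LinearMap.range f →ₗ[A] Y :=
      (LinearMap.ker f).liftQ h hker ∘ₗ f.quotKerEquivRange.symm.toLinearMap
    have hh' (q : Q) : h' ⟨f q, q, rfl⟩ = h q := by
      have : f.quotKerEquivRange.symm ⟨f q, q, rfl⟩ = (LinearMap.ker f).mkQ q := by
        rw [LinearEquiv.symm_apply_eq]
        rfl
      simp [h', this]
    obtain ⟨k, hk⟩ := Abelian.Ext.contravariant_sequence_exact₁ hS (ModuleCat.of A Y)
      (Abelian.Ext.mk₀ (ModuleCat.ofHom h')) (add_zero 1) (Subsingleton.elim _ _)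
    obtain ⟨k, rfl⟩ := (Abelian.Ext.mk₀_bijective _ _).2 k
    rw [Abelian.Ext.mk₀_comp_mk₀] at hk
    have hk' := (Abelian.Ext.mk₀_bijective _ _).1 hk
    refine ⟨k.hom, LinearMap.ext fun q => ?_⟩
    rw [← hh' q]
    exact congrArg (fun φ => φ.hom ⟨f q, q, rfl⟩) hk'
  · intro H
    refine subsingleton_of_forall_eq 0 fun e => ?_
    obtain ⟨x, rfl⟩ := Abelian.Ext.contravariant_sequence_exact₃ hS (ModuleCat.of A Y) e
      (Abelian.Ext.eq_zero_of_projective _) (add_zero 1)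
    obtain ⟨h, rfl⟩ := (Abelian.Ext.mk₀_bijective _ _).2 x
    obtain ⟨k, hk⟩ := H (h.hom ∘ₗ f.rangeRestrict) fun q hq => by
      have : f.rangeRestrict q = 0 := Subtype.ext hq
      simp [this]
    have : h = S.f ≫ ModuleCat.ofHom k := by
      ext ⟨_, q, rfl⟩
      exact (LinearMap.congr_fun hk q).symm
    rw [this, ← Abelian.Ext.mk₀_comp_mk₀, hS.extClass_comp_assoc]

end Ext

/-! ### Duality for finitely generated projectives. -/

section RingDual

open MulOpposite

variable {A : Type*} [Ring A]

theorem isTorsionless_iff {X : Type*} [AddCommGroup X] [Module A X] :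
    IsTorsionless A X ↔ ∀ x : X, (∀ φ : X →ₗ[A] A, φ x = 0) → x = 0 := by
  rw [IsTorsionless, injective_iff_map_eq_zero]
  exact forall_congr' fun x => imp_congr_left LinearMap.ext_iff

/-- Over the opposite ring, torsionlessness may be tested on the right module `A`. -/
theorem isTorsionless_mulOpposite_iff {X : Type*} [AddCommGroup X] [Module Aᵐᵒᵖ X] :
    IsTorsionless Aᵐᵒᵖ X ↔ ∀ x : X, (∀ φ : X →ₗ[Aᵐᵒᵖ] A, φ x = 0) → x = 0 := by
  rw [isTorsionless_iff]
  refine forall_congr' fun x => imp_congr_left ⟨fun h φ => ?_, fun h φ => ?_⟩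
  · let ψ : X →ₗ[Aᵐᵒᵖ] Aᵐᵒᵖ :=
      { toFun := fun y => op (φ y)
        map_add' := fun y z => by simp
        map_smul' := fun a y => by simp }
    exact op_injective (h ψ)
  · let ψ : X →ₗ[Aᵐᵒᵖ] A :=
      { toFun := fun y => unop (φ y)
        map_add' := fun y z => by simp
        map_smul' := fun a y => by simp }
    exact unop_injective (h ψ)

variable {P : Type*} [AddCommGroup P] [Module A P]

/-- The dual basis lemma for finitely generated projective modules. -/
theorem exists_finite_dual_basis [Module.Finite A P] [Module.Projective A P] :
    ∃ (n : ℕ) (e : Fin n → P) (φ : Fin n → P →ₗ[A] A), ∀ x, ∑ i, φ i x • e i = x := by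
  obtain ⟨n, p, s, -, -, hps⟩ := Module.Finite.exists_comp_eq_id_of_projective A P
  refine ⟨n, fun i => p fun j => if i = j then 1 else 0,
    fun i => LinearMap.proj i ∘ₗ s, fun x => ?_⟩
  exact (p.pi_apply_eq_sum_univ (s x)).symm.trans (LinearMap.congr_fun hps x)

theorem sum_op_smul_eq {n : ℕ} {e : Fin n → P} {φ : Fin n → P →ₗ[A] A}
    (h : ∀ x, ∑ i, φ i x • e i = x) (ψ : P →ₗ[A] A) : ∑ i, op (ψ (e i)) • φ i = ψ := by
  ext x
  conv_rhs => rw [← h x]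
  simp

theorem projective_ringDual [Module.Finite A P] [Module.Projective A P] :
    Module.Projective Aᵐᵒᵖ (P →ₗ[A] A) := by
  obtain ⟨n, e, φ, h⟩ := exists_finite_dual_basis (A := A) (P := P)
  let s : (P →ₗ[A] A) →ₗ[Aᵐᵒᵖ] (Fin n → Aᵐᵒᵖ) :=
    { toFun := fun ψ i => op (ψ (e i))
      map_add' := fun _ _ => by ext; simp
      map_smul' := fun a ψ => by ext; simp }
  refine Module.Projective.of_split s (Fintype.linearCombination Aᵐᵒᵖ φ) ?_
  ext ψ : 1
  simpa [Fintype.linearCombination_apply, s] using sum_op_smul_eq h ψ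

/-- Finitely generated projective modules are reflexive. -/
theorem exists_eval_eq [Module.Finite A P] [Module.Projective A P]
    (χ : (P →ₗ[A] A) →ₗ[Aᵐᵒᵖ] A) : ∃ q : P, ∀ ψ, χ ψ = ψ q := by
  obtain ⟨n, e, φ, h⟩ := exists_finite_dual_basis (A := A) (P := P)
  refine ⟨∑ i, χ (φ i) • e i, fun ψ => ?_⟩
  conv_lhs => rw [← sum_op_smul_eq h ψ]
  simp

theorem eq_zero_of_forall_ringDual [Module.Finite A P] [Module.Projective A P] {x : P}
    (hx : ∀ ψ : P →ₗ[A] A, ψ x = 0) : x = 0 := by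
  obtain ⟨n, e, φ, h⟩ := exists_finite_dual_basis (A := A) (P := P)
  rw [← h x]
  simp [hx]

end RingDual

/-! ### The transpose. -/

section Transpose

open MulOpposite

variable {A : Type*} [Ring A] {P Q M : Type*} [AddCommGroup P] [Module A P]
  [AddCommGroup Q] [Module A Q] [AddCommGroup M] [Module A M]

/-- The cokernel of `f^*` is torsionless if and only if every linear form vanishing on the kernel
of `f` factors through `f`. -/
theorem isTorsionless_cokerDual_iff [Module.Finite A Q] [Module.Projective A Q]
    [Module.Finite A P] [Module.Projective A P] (f : Q →ₗ[A] P) :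
    IsTorsionless Aᵐᵒᵖ (CokerDual f) ↔
      ∀ h : Q →ₗ[A] A, LinearMap.ker f ≤ LinearMap.ker h → ∃ k : P →ₗ[A] A, k ∘ₗ f = h := by
  rw [isTorsionless_mulOpposite_iff, (Submodule.mkQ_surjective _).forall]
  refine forall_congr' fun h => imp_congr ⟨fun H q hq => ?_, fun H χ => ?_⟩ ?_
  · let ev : (Q →ₗ[A] A) →ₗ[Aᵐᵒᵖ] A := evalBidual A Q q
    refine H ((LinearMap.range (ringDualMap f)).liftQ ev ?_)
    rintro _ ⟨ψ, rfl⟩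
    change ψ (f q) = 0
    rw [LinearMap.mem_ker.1 hq, map_zero]
  · obtain ⟨q, hq⟩ := exists_eval_eq (χ ∘ₗ (LinearMap.range (ringDualMap f)).mkQ)
    refine (hq h).trans (H ?_)
    refine eq_zero_of_forall_ringDual (A := A) fun ψ => ?_
    have h0 : (LinearMap.range (ringDualMap f)).mkQ (ringDualMap f ψ) = 0 :=
      (Submodule.Quotient.mk_eq_zero _).2 ⟨ψ, rfl⟩
    have := hq (ringDualMap f ψ)
    rw [LinearMap.comp_apply, h0, map_zero] at this
    exact this.symm
  · exact Submodule.Quotient.mk_eq_zero _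

/-- A nonzero right module over a semiprimary ring has a nonzero element annihilated by the
Jacobson radical. -/
theorem exists_ne_zero_jacobson_smul_eq_zero [IsSemiprimaryRing A] {N : Type*} [AddCommGroup N]
    [Module Aᵐᵒᵖ N] [Nontrivial N] : ∃ s : N, s ≠ 0 ∧ ∀ a ∈ Ring.jacobson A, op a • s = 0 := by
  by_contra! H
  -- Otherwise elements of the radical can be applied forever without reaching zero, contradicting
  -- its nilpotency.
  have key (k : ℕ) : ∀ s : N, s ≠ 0 → ∃ c ∈ Ring.jacobson A ^ k, op c • s ≠ 0 := by
    induction k with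
    | zero =>
      intro s hs
      refine ⟨1, ?_, by simpa using hs⟩
      rw [Submodule.pow_zero, Ideal.one_eq_top]
      trivial
    | succ k ih =>
      intro s hs
      obtain ⟨a, ha, has⟩ := H s hs
      obtain ⟨c, hc, hcs⟩ := ih _ has
      refine ⟨a * c, ?_, by rwa [op_mul, mul_smul]⟩
      rw [Ideal.IsTwoSided.pow_succ]
      exact Ideal.mul_mem_mul ha hc
  obtain ⟨n, hn⟩ := IsSemiprimaryRing.isNilpotent (R := A)
  obtain ⟨s, hs⟩ := exists_ne (0 : N)
  obtain ⟨c, hc, hcs⟩ := key n s hs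
  rw [hn] at hc
  exact hcs (by rw [show c = 0 from hc]; simp)

/-- If all `b * a` were nilpotent, all `1 + b * a` would be units, placing `a` in the radical. -/
theorem exists_not_isNilpotent_mul {a : A} (ha : a ∉ Ring.jacobson A) :
    ∃ b, ¬ IsNilpotent (b * a) := by
  by_contra! H
  refine ha ?_
  rw [← Ideal.jacobson_bot, Ideal.mem_jacobson_iff]
  intro y
  obtain ⟨u, hu⟩ := (H y).isUnit_one_add
  refine ⟨↑u⁻¹, ?_⟩
  have := u.inv_mul
  rw [hu, mul_add, mul_one] at this
  rw [Ideal.mem_bot, mul_assoc, sub_eq_zero, add_comm]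
  exact this

/-- If the cokernel of `f^*` is torsionless with vanishing self-extensions, where `f` presents a
faithful module all of whose linear forms take values in the Jacobson radical, then `f^*` is
surjective. -/
theorem range_ringDualMap_eq_top [IsSemiprimaryRing A] [Module.Finite A Q] [Module.Projective A Q]
    [Module.Finite A P] [Module.Projective A P] {f : Q →ₗ[A] P} {g : P →ₗ[A] M}
    (hfg : Function.Exact f g) (hg : Function.Surjective g)
    (hM : Module.annihilator A M = ⊥) (hrad : ∀ (φ : M →ₗ[A] A) m, φ m ∈ Ring.jacobson A)
    (htor : IsTorsionless Aᵐᵒᵖ (CokerDual f))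
    (hext : ∀ h : (P →ₗ[A] A) →ₗ[Aᵐᵒᵖ] CokerDual f,
      LinearMap.ker (ringDualMap f) ≤ LinearMap.ker h →
        ∃ k : (Q →ₗ[A] A) →ₗ[Aᵐᵒᵖ] CokerDual f, k ∘ₗ ringDualMap f = h) :
    LinearMap.range (ringDualMap f) = ⊤ := by
  by_contra hne
  have : Nontrivial (CokerDual f) := Submodule.Quotient.nontrivial_iff.2 hne
  obtain ⟨s, hs, hsJ⟩ := exists_ne_zero_jacobson_smul_eq_zero (A := A) (N := CokerDual f)
  refine hs (isTorsionless_mulOpposite_iff.1 htor s fun χ => ?_)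
  rw [← Ideal.mem_bot, ← hM, Module.mem_annihilator]
  intro m
  obtain ⟨p, rfl⟩ := hg m
  let h : (P →ₗ[A] A) →ₗ[Aᵐᵒᵖ] CokerDual f :=
    { toFun := fun φ => op (φ p) • s
      map_add' := fun φ ψ => by simp [add_smul]
      map_smul' := fun a φ => by simp [mul_smul] }
  obtain ⟨θ, hθ⟩ := hext h fun φ hφ => by
    have hφ' : LinearMap.ker g ≤ LinearMap.ker φ := by
      intro x hx
      obtain ⟨q, rfl⟩ := (hfg x).1 hx
      exact LinearMap.congr_fun hφ q
    let φ' : M →ₗ[A] A := (LinearMap.ker g).liftQ φ hφ' ∘ₗ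
      (g.quotKerEquivOfSurjective hg).symm.toLinearMap
    have h1 : φ' (g p) = φ p := by
      have : (g.quotKerEquivOfSurjective hg).symm (g p) = (LinearMap.ker g).mkQ p := by
        rw [LinearEquiv.symm_apply_eq]
        rfl
      simp [φ', this]
    exact hsJ _ (h1 ▸ hrad φ' (g p))
  obtain ⟨q, hq⟩ := exists_eval_eq (χ ∘ₗ θ)
  have hqp : f q - χ s • p = 0 := eq_zero_of_forall_ringDual (A := A) fun φ => by
    have h1 := hq (ringDualMap f φ)
    have h2 : θ (ringDualMap f φ) = op (φ p) • s := LinearMap.congr_fun hθ φ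
    rw [LinearMap.comp_apply, h2, map_smul, op_smul_eq_mul] at h1
    have h3 : ringDualMap f φ q = φ (f q) := rfl
    rw [map_sub, map_smul, smul_eq_mul, h1, h3, sub_self]
  rw [← map_smul, ← sub_eq_zero.1 hqp]
  exact hfg.apply_apply_eq_zero q

/-- If `f^*` is surjective, then `f` is a split monomorphism and its cokernel is projective. -/
theorem projective_of_range_ringDualMap_eq_top [Module.Finite A Q] [Module.Projective A Q]
    [Module.Projective A P] {f : Q →ₗ[A] P} {g : P →ₗ[A] M}
    (hfg : Function.Exact f g) (hg : Function.Surjective g)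
    (h : LinearMap.range (ringDualMap f) = ⊤) : Module.Projective A M := by
  obtain ⟨n, e, φ, he⟩ := exists_finite_dual_basis (A := A) (P := Q)
  choose ψ hψ using fun i => LinearMap.range_eq_top.1 h (φ i)
  -- Lifting the dual basis of `Q` through `f^*` gives a retraction of `f`.
  let r : P →ₗ[A] Q := ∑ i, (ψ i).smulRight (e i)
  have hr : r ∘ₗ f = LinearMap.id := by
    ext q
    have (i : Fin n) : ψ i (f q) = φ i q := LinearMap.congr_fun (hψ i) q
    simp [r, this, he]
  have hsplit := (hfg.split_tfae' (f := f) (g := g)).out 1 0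
  obtain ⟨l, hl⟩ := (hsplit.1 ⟨hg, r, hr⟩).2
  exact Module.Projective.of_split l g hl

end Transpose

/-! ### Indecomposable modules and forms outside the radical. -/

section Indecomposable

variable {A : Type u} [Ring A] {M : Type u} [AddCommGroup M] [Module A M]

theorem eq_bot_or_eq_bot_of_indecomposable (hM : Indecomposable (ModuleCat.of A M))
    {p q : Submodule A M} (hpq : IsCompl p q) : p = ⊥ ∨ q = ⊥ := by
  have := hM.2 (ModuleCat.of A p) (ModuleCat.of A q)
    ((Submodule.prodEquivOfIsCompl p q hpq).symm.toModuleIso ≪≫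
      (ModuleCat.biprodIsoProd (ModuleCat.of A p) (ModuleCat.of A q)).symm)
  exact this.imp
    (fun h => Submodule.subsingleton_iff_eq_bot.1 (ModuleCat.isZero_iff_subsingleton.1 h))
    (fun h => Submodule.subsingleton_iff_eq_bot.1 (ModuleCat.isZero_iff_subsingleton.1 h))

/-- Fitting's lemma. -/
theorem isNilpotent_or_bijective_of_indecomposable [IsArtinian A M] [IsNoetherian A M]
    (hM : Indecomposable (ModuleCat.of A M)) (h : Module.End A M) :
    IsNilpotent h ∨ Function.Bijective h := by
  obtain ⟨n, hn⟩ := Filter.eventually_atTop.1 h.eventually_isCompl_ker_pow_range_pow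
  -- A positive exponent, so that injectivity of the power passes to `h`.
  have hc := hn (n + 1) n.le_succ
  rcases eq_bot_or_eq_bot_of_indecomposable hM hc with hk | hr
  · right
    have hi : Function.Injective (h ^ (n + 1)) := LinearMap.ker_eq_bot.1 hk
    rw [pow_succ] at hi
    have hi' : Function.Injective h := Function.Injective.of_comp (f := (h ^ n : Module.End A M)) hi
    exact ⟨hi', IsArtinian.surjective_of_injective_endomorphism h hi'⟩
  · exact Or.inl ⟨n + 1, LinearMap.range_eq_bot.1 hr⟩

/-- A finite length indecomposable module with a linear form not taking values in the Jacobson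
radical is projective. -/
theorem projective_of_notMem_jacobson [IsArtinian A M] [IsNoetherian A M]
    (hM : Indecomposable (ModuleCat.of A M)) (φ : M →ₗ[A] A) {m : M}
    (hm : φ m ∉ Ring.jacobson A) : Module.Projective A M := by
  obtain ⟨b, hb⟩ := exists_not_isNilpotent_mul hm
  -- This endomorphism factors through `A` and is not nilpotent; once bijective, it makes `M` a
  -- direct summand of `A`.
  let h : Module.End A M := φ.smulRight (b • m)
  have hpow (n : ℕ) (x : M) : φ ((h ^ n) x) = φ x * (b * φ m) ^ n := by
    induction n with
    | zero => simp
    | succ n ih =>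
      rw [pow_succ', Module.End.mul_apply]
      simp [h, ih, pow_succ, mul_assoc]
  have hbij : Function.Bijective h := by
    refine (isNilpotent_or_bijective_of_indecomposable hM h).resolve_left ?_
    rintro ⟨n, hn⟩
    refine hb ⟨n + 1, ?_⟩
    rw [pow_succ', mul_assoc, ← hpow, hn]
    simp
  let e := LinearEquiv.ofBijective h hbij
  refine Module.Projective.of_split φ
    (e.symm.toLinearMap ∘ₗ LinearMap.toSpanSingleton A M (b • m)) (LinearMap.ext fun x => ?_)
  exact e.symm_apply_apply x

end Indecomposable

theorem proposition3p6 (R : Type w) [CommRing R] [IsArtinianRing R]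
    (Λ : Type u) [Ring Λ] [Algebra R Λ] [Module.Finite R Λ]
    (M : Type u) [AddCommGroup M] [Module Λ M] [Module.Finite Λ M]
    (hfaithful : Module.annihilator Λ M = ⊥)
    (hindec : Indecomposable (ModuleCat.of Λ M))
    (P₁ P₀ : Type u) [AddCommGroup P₁] [Module Λ P₁] [AddCommGroup P₀] [Module Λ P₀]
    (f : P₁ →ₗ[Λ] P₀) (g : P₀ →ₗ[Λ] M)
    (hmin : IsMinimalProjectivePresentation f g) :
    (IsTorsionless Λᵐᵒᵖ (CokerDual f) ↔
      Subsingleton (Abelian.Ext (ModuleCat.of Λ M) (ModuleCat.of Λ Λ) 1)) ∧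
    (IsTorsionless Λᵐᵒᵖ (CokerDual f) →
      Subsingleton (Abelian.Ext (ModuleCat.of Λᵐᵒᵖ (CokerDual f))
        (ModuleCat.of Λᵐᵒᵖ (CokerDual f)) 1) →
      Module.Projective Λ M) := by
  have := hmin.finite₁
  have := hmin.finite₀
  have := hmin.projective₁
  have := hmin.projective₀
  have : IsArtinianRing Λ := IsArtinianRing.of_finite R Λ
  refine ⟨(isTorsionless_cokerDual_iff f).trans
    (subsingleton_ext_one_iff hmin.exact hmin.surjective).symm, fun htor hext => ?_⟩
  by_contra hproj
  -- The `Ext¹` criterion is applied to `P₀^* → P₁^* → Tr M → 0`, whose middle term must be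
  -- projective.
  have := projective_ringDual (A := Λ) (P := P₁)
  refine hproj (projective_of_range_ringDualMap_eq_top hmin.exact hmin.surjective
    (range_ringDualMap_eq_top hmin.exact hmin.surjective hfaithful (fun φ m => ?_) htor
      ((subsingleton_ext_one_iff (LinearMap.exact_map_mkQ_range _)
        (Submodule.mkQ_surjective _)).1 hext)))
  by_contra hm
  exact hproj (projective_of_notMem_jacobson hindec φ hm)
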